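/- Let $K$ be a number field with ring of integers $\mathcal O_K$, and let $V$ be the set of its places, each represented by its usual normalised absolute value $|\cdot|_v$ (so $V$ contains exactly one nontrivial absolute value from each equivalence class); let $Arch\subset V$ be the set of Archimedean places. Let $*$ be a countably saturated nonstandard embedding, ${}^*K$ the corresponding nonstandard extension of $K$, and extend each $|\cdot|_v$ to an internal absolute value ${}^*K\to{}^*\mathbb R$. Endow ${}^*K$ with the uniform structure generated by the entourages $\{(x,y) : |x-y|_v<\varepsilon\}$ for $v\in V$ and standard real $\varepsilon>0$, and with the induced topology. Put $$\mathrm{inf}_V({}^*K)=\{x\in{}^*K : |x|_v \text{ is infinitesimal for all } v\in V\},$$ and for each finite $S\subset V$ let $\mathrm{fin}_{V,S}({}^*K)$ be the subring of all $x\in{}^*K$ such that $|x|_v$ is finite (bounded by a standard real number) for all $v\in V$, and $|x|_v\le 1$ for all $v\in V\setminus(S\cup Arch)$. Let $$U_{V,S}({}^*K)=\mathrm{fin}_{V,S}({}^*K)^\times$$ be its unit group, i.e. the group of all $x\in({}^*K)^\times$ such that $x$ and $x^{-1}$ are finite at all $v\in V$ and $|x|_v=1$ for all $v\in V\setminus(S\cup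 Arch)$, with the subspace topology from ${}^*K$. Let $$U_V({}^*K)=\varinjlim_S U_{V,S}({}^*K)=\bigcup_S U_{V,S}({}^*K)$$ be the direct limit over the finite subsets $S\subset V$, ordered by inclusion, with the final topology with respect to the inclusions of the $U_{V,S}({}^*K)$. Let $(A_K)^\times$ be the idele group of $K$, i.e. the unit group of the adele ring with its usual topology. **Proposition.** $U_V({}^*K)$ is a topological group and is locally quasi-compact (each point has a neighbourhood basis of quasi-compact sets; no Hausdorff condition). The canonical map $$\varphi: U_V({}^*K)\to (A_K)^\times,$$ which sends $x$ to the family $(\alpha_v)_{v\in V}$ of its standard parts (that is, $\alpha_v\in K_v$ and $|x-\alpha_v|_v$, computed in ${}^*(K_v)$, is infinitesimal for all $v\in V$), is a well-defined, continuous and surjective group homomorphism. Its kernel is $1+\mathrm{inf}_V({}^*K)=\overline{\{1\}}$, the closure being taken in $U_V({}^*K)$. It induces an isomorphism of groups $$U_V({}^*K)/(1+\mathrm{inf}_V({}^*K))\;\cong\;(A_K)^\times$$ which is a homeomorphism for the quotient topology; in other words, the ideles are the Hausdorff topological group associated with $U_V({}^*K)$. -/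

import Mathlib

open scoped NumberField
open IsDedekindDomain

universe u w

/-- A nonstandard extension (nonstandard embedding) `*`, acting on all sets (types) `X`,
functions `f : X → Y`, points `x ∈ X` and subsets `A ⊆ X`:
`Ext X` is `*X`, `map f` is `*f`, `std x` is `*x`, and `setExt A` is `*A`.

The laws are the transfer principle, one clause for each logical construction: substitution of
functions (`setExt_preimage`), conjunction, negation, equality and existential quantification
(`setExt_inter`, `setExt_compl`, `setExt_diagonal`, `setExt_image`), with finitely many variables
(`pair_bijective`: `*(X × Y) = *X × *Y`). Relations are treated as subsets of products, and
higher order objects through the sets `Set X`, `Set (Set X)`, and so on. -/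
structure NonstandardExtension where
  Ext : Type u → Type w
  map : ∀ {X Y : Type u}, (X → Y) → Ext X → Ext Y
  std : ∀ {X : Type u}, X → Ext X
  setExt : ∀ {X : Type u}, Set X → Set (Ext X)
  map_id : ∀ {X : Type u} (x : Ext X), map (fun t : X => t) x = x
  map_comp : ∀ {X Y Z : Type u} (g : Y → Z) (f : X → Y) (x : Ext X),
    map g (map f x) = map (fun t => g (f t)) x
  map_std : ∀ {X Y : Type u} (f : X → Y) (x : X), map f (std x) = std (f x)
  pair_bijective : ∀ (X Y : Type u), Function.Bijective
    (fun z : Ext (X × Y) => (map Prod.fst z, map Prod.snd z))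
  std_mem_setExt : ∀ {X : Type u} (x : X) (A : Set X), std x ∈ setExt A ↔ x ∈ A
  setExt_compl : ∀ {X : Type u} (A : Set X), setExt Aᶜ = (setExt A)ᶜ
  setExt_inter : ∀ {X : Type u} (A B : Set X), setExt (A ∩ B) = setExt A ∩ setExt B
  setExt_preimage : ∀ {X Y : Type u} (f : X → Y) (A : Set Y),
    setExt (f ⁻¹' A) = map f ⁻¹' setExt A
  setExt_image : ∀ {X Y : Type u} (f : X → Y) (A : Set X),
    setExt (f '' A) = map f '' setExt A
  setExt_diagonal : ∀ (X : Type u),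
    setExt {p : X × X | p.1 = p.2} = {z | map Prod.fst z = map Prod.snd z}

namespace NonstandardExtension

variable (E : NonstandardExtension.{u, w})

/-- The element of `*(X × Y)` corresponding to the pair `(x, y) ∈ *X × *Y`. -/
noncomputable def pair {X Y : Type u} (x : E.Ext X) (y : E.Ext Y) : E.Ext (X × Y) :=
  (Equiv.ofBijective _ (E.pair_bijective X Y)).symm (x, y)

/-- The extension of a function of two variables. -/
noncomputable def map₂ {X Y Z : Type u} (f : X → Y → Z) (x : E.Ext X) (y : E.Ext Y) : E.Ext Z :=
  E.map (fun p : X × Y => f p.1 p.2) (E.pair x y)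

/-- The extension of a binary relation. -/
def Rel {X Y : Type u} (R : X → Y → Prop) (x : E.Ext X) (y : E.Ext Y) : Prop :=
  E.pair x y ∈ E.setExt {p : X × Y | R p.1 p.2}

/-- An internal subset of `*X` is an element `a` of `*(𝒫 X)`, identified with the set of all
`x ∈ *X` such that `x *∈ a`. -/
def IsInternal {X : Type u} (A : Set (E.Ext X)) : Prop :=
  ∃ a : E.Ext (Set X), A = {x | E.Rel (fun (t : X) (B : Set X) => t ∈ B) x a}

/-- Countable saturation: a countable family of internal sets with the finite intersection
property has nonempty intersection. -/
def CountablySaturated : Prop :=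
  ∀ (X : Type u) (A : ℕ → Set (E.Ext X)), (∀ n, E.IsInternal (A n)) →
    (∀ F : Finset ℕ, (⋂ n ∈ F, A n).Nonempty) → (⋂ n, A n).Nonempty

section basic

variable {E}

lemma map_fst_pair {X Y : Type u} (x : E.Ext X) (y : E.Ext Y) :
    E.map Prod.fst (E.pair x y) = x :=
  congrArg Prod.fst ((Equiv.ofBijective _ (E.pair_bijective X Y)).apply_symm_apply (x, y))

lemma map_snd_pair {X Y : Type u} (x : E.Ext X) (y : E.Ext Y) :
    E.map Prod.snd (E.pair x y) = y :=
  congrArg Prod.snd ((Equiv.ofBijective _ (E.pair_bijective X Y)).apply_symm_apply (x, y))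

lemma ext_pair {X Y : Type u} {z z' : E.Ext (X × Y)} (h1 : E.map Prod.fst z = E.map Prod.fst z')
    (h2 : E.map Prod.snd z = E.map Prod.snd z') : z = z' :=
  (E.pair_bijective X Y).1 (Prod.ext h1 h2)

lemma map_const {X Y : Type u} (y : Y) (x : E.Ext X) : E.map (fun _ => y) x = E.std y := by
  have hd : E.setExt (Set.univ : Set X) = Set.univ := by
    have h0 : E.setExt (∅ : Set X) = ∅ := by
      have h := E.setExt_inter (∅ : Set X) (∅ : Set X)ᶜ
      rw [E.setExt_compl] at h
      simpa using h
    have h := E.setExt_compl (∅ : Set X)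
    rwa [h0, Set.compl_empty, Set.compl_empty] at h
  have hm : E.map (fun _ => y) x ∈ E.setExt ({y} : Set Y) := by
    have h := E.setExt_preimage (fun _ : X => y) ({y} : Set Y)
    have h' : ((fun _ : X => y) ⁻¹' ({y} : Set Y)) = Set.univ := by
      ext t; simp
    rw [h', hd] at h
    have : x ∈ (Set.univ : Set (E.Ext X)) := trivial
    rw [h] at this
    exact this
  have hs : E.pair (E.map (fun _ => y) x) (E.std y) ∈ E.setExt {p : Y × Y | p.1 = p.2} := by
    have hsub : (Prod.fst ⁻¹' ({y} : Set Y)) ∩ (Prod.snd ⁻¹' ({y} : Set Y)) =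
        ((Prod.fst ⁻¹' ({y} : Set Y)) ∩ (Prod.snd ⁻¹' ({y} : Set Y))) ∩
          {p : Y × Y | p.1 = p.2} := by
      ext p
      simp only [Set.mem_inter_iff, Set.mem_preimage, Set.mem_singleton_iff, Set.mem_ofPred_eq]
      constructor
      · rintro ⟨a, b⟩; exact ⟨⟨a, b⟩, a.trans b.symm⟩
      · exact fun h => h.1
    have hmem : E.pair (E.map (fun _ => y) x) (E.std y) ∈
        E.setExt ((Prod.fst ⁻¹' ({y} : Set Y)) ∩ (Prod.snd ⁻¹' ({y} : Set Y))) := by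
      rw [E.setExt_inter, E.setExt_preimage, E.setExt_preimage]
      refine ⟨?_, ?_⟩
      · rw [Set.mem_preimage, map_fst_pair]; exact hm
      · rw [Set.mem_preimage, map_snd_pair, E.std_mem_setExt]; rfl
    rw [hsub, E.setExt_inter] at hmem
    exact hmem.2
  rw [E.setExt_diagonal] at hs
  have hs' : E.map Prod.fst (E.pair (E.map (fun _ => y) x) (E.std y)) =
      E.map Prod.snd (E.pair (E.map (fun _ => y) x) (E.std y)) := hs
  rwa [map_fst_pair, map_snd_pair] at hs'

lemma pair_map {W X Y : Type u} (f : W → X) (g : W → Y) (t : E.Ext W) :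
    E.pair (E.map f t) (E.map g t) = E.map (fun s => (f s, g s)) t := by
  apply ext_pair
  · rw [map_fst_pair, E.map_comp]
  · rw [map_snd_pair, E.map_comp]

lemma map₂_map {W X Y Z : Type u} (f : X → Y → Z) (a : W → X) (b : W → Y) (t : E.Ext W) :
    E.map₂ f (E.map a t) (E.map b t) = E.map (fun s => f (a s) (b s)) t := by
  rw [map₂, pair_map, E.map_comp]

/-- Identities in one variable transfer. -/
lemma exists_one {X : Type u} (x : E.Ext X) :
    ∃ t : E.Ext X, x = E.map (fun s => s) t := ⟨x, (E.map_id x).symm⟩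

lemma exists_two {X Y : Type u} (x : E.Ext X) (y : E.Ext Y) :
    ∃ t : E.Ext (X × Y), x = E.map (fun s => s.1) t ∧ y = E.map (fun s => s.2) t :=
  ⟨E.pair x y, (map_fst_pair x y).symm, (map_snd_pair x y).symm⟩

lemma exists_three {X Y Z : Type u} (x : E.Ext X) (y : E.Ext Y) (z : E.Ext Z) :
    ∃ t : E.Ext (X × Y × Z), x = E.map (fun s => s.1) t ∧ y = E.map (fun s => s.2.1) t ∧
      z = E.map (fun s => s.2.2) t := by
  refine ⟨E.pair x (E.pair y z), (map_fst_pair x _).symm, ?_, ?_⟩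
  · have h := E.map_comp (Prod.fst : Y × Z → Y) (Prod.snd : X × Y × Z → Y × Z)
      (E.pair x (E.pair y z))
    rw [map_snd_pair, map_fst_pair] at h
    exact h
  · have h := E.map_comp (Prod.snd : Y × Z → Z) (Prod.snd : X × Y × Z → Y × Z)
      (E.pair x (E.pair y z))
    rw [map_snd_pair, map_snd_pair] at h
    exact h

lemma setExt_mono {X : Type u} {A B : Set X} (h : A ⊆ B) : E.setExt A ⊆ E.setExt B := by
  have h' := E.setExt_inter A B
  rw [Set.inter_eq_left.2 h] at h'
  rw [h']
  exact Set.inter_subset_right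

lemma map_mem {X Y : Type u} {f : X → Y} {A : Set X} {B : Set Y} (h : ∀ x ∈ A, f x ∈ B)
    {x : E.Ext X} (hx : x ∈ E.setExt A) : E.map f x ∈ E.setExt B := by
  have h' : A ⊆ f ⁻¹' B := h
  have := setExt_mono (E := E) h' hx
  rw [E.setExt_preimage] at this
  exact this

lemma map₂_mem {X Y Z : Type u} {f : X → Y → Z} {A : Set X} {B : Set Y} {C : Set Z}
    (h : ∀ x ∈ A, ∀ y ∈ B, f x y ∈ C) {x : E.Ext X} {y : E.Ext Y}
    (hx : x ∈ E.setExt A) (hy : y ∈ E.setExt B) : E.map₂ f x y ∈ E.setExt C := by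
  refine map_mem (A := Prod.fst ⁻¹' A ∩ Prod.snd ⁻¹' B) (fun p hp => h p.1 hp.1 p.2 hp.2) ?_
  rw [E.setExt_inter, E.setExt_preimage, E.setExt_preimage]
  refine ⟨?_, ?_⟩
  · rw [Set.mem_preimage, map_fst_pair]; exact hx
  · rw [Set.mem_preimage, map_snd_pair]; exact hy

lemma rel_map_std {X Y Z : Type u} (R : Y → Z → Prop) (f : X → Y) (x : E.Ext X) (c : Z) :
    E.Rel R (E.map f x) (E.std c) ↔ x ∈ E.setExt {t | R (f t) c} := by
  rw [Rel, ← map_const c x, pair_map]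
  have h := E.setExt_preimage (fun s : X => (f s, c)) {p : Y × Z | R p.1 p.2}
  exact (Set.ext_iff.1 h x).symm

end basic

section ring

variable (R : Type u) [CommRing R]

instance : Zero (E.Ext R) := ⟨E.std 0⟩

instance : One (E.Ext R) := ⟨E.std 1⟩

noncomputable instance : Add (E.Ext R) := ⟨E.map₂ (fun x y => x + y)⟩

noncomputable instance : Mul (E.Ext R) := ⟨E.map₂ (fun x y => x * y)⟩

instance : Neg (E.Ext R) := ⟨E.map (fun x => -x)⟩

/-- The ring structure of `*R`: the operations are the extensions of those of `R`. -/
noncomputable instance instCommRing : CommRing (E.Ext R) where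
  nsmul := nsmulRec
  zsmul := zsmulRec
  add_assoc x y z := by
    obtain ⟨t, rfl, rfl, rfl⟩ := exists_three x y z
    change E.map₂ _ (E.map₂ _ _ _) _ = E.map₂ _ _ (E.map₂ _ _ _)
    simp only [map₂_map, add_assoc]
  mul_assoc x y z := by
    obtain ⟨t, rfl, rfl, rfl⟩ := exists_three x y z
    change E.map₂ _ (E.map₂ _ _ _) _ = E.map₂ _ _ (E.map₂ _ _ _)
    simp only [map₂_map, mul_assoc]
  left_distrib x y z := by
    obtain ⟨t, rfl, rfl, rfl⟩ := exists_three x y z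
    change E.map₂ _ _ (E.map₂ _ _ _) = E.map₂ _ (E.map₂ _ _ _) (E.map₂ _ _ _)
    simp only [map₂_map, mul_add]
  right_distrib x y z := by
    obtain ⟨t, rfl, rfl, rfl⟩ := exists_three x y z
    change E.map₂ _ (E.map₂ _ _ _) _ = E.map₂ _ (E.map₂ _ _ _) (E.map₂ _ _ _)
    simp only [map₂_map, add_mul]
  add_comm x y := by
    obtain ⟨t, rfl, rfl⟩ := exists_two x y
    change E.map₂ _ _ _ = E.map₂ _ _ _
    simp only [map₂_map, add_comm]
  mul_comm x y := by
    obtain ⟨t, rfl, rfl⟩ := exists_two x y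
    change E.map₂ _ _ _ = E.map₂ _ _ _
    simp only [map₂_map, mul_comm]
  zero_add x := by
    obtain ⟨t, rfl⟩ := exists_one x
    change E.map₂ _ (E.std 0) _ = _
    rw [← map_const (0 : R) t]
    simp only [map₂_map, zero_add]
  add_zero x := by
    obtain ⟨t, rfl⟩ := exists_one x
    change E.map₂ _ _ (E.std 0) = _
    rw [← map_const (0 : R) t]
    simp only [map₂_map, add_zero]
  one_mul x := by
    obtain ⟨t, rfl⟩ := exists_one x
    change E.map₂ _ (E.std 1) _ = _
    rw [← map_const (1 : R) t]
    simp only [map₂_map, one_mul]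
  mul_one x := by
    obtain ⟨t, rfl⟩ := exists_one x
    change E.map₂ _ _ (E.std 1) = _
    rw [← map_const (1 : R) t]
    simp only [map₂_map, mul_one]
  zero_mul x := by
    obtain ⟨t, rfl⟩ := exists_one x
    change E.map₂ _ (E.std 0) _ = E.std 0
    rw [← map_const (0 : R) t]
    simp only [map₂_map, zero_mul]
  mul_zero x := by
    obtain ⟨t, rfl⟩ := exists_one x
    change E.map₂ _ _ (E.std 0) = E.std 0
    rw [← map_const (0 : R) t]
    simp only [map₂_map, mul_zero]
  neg_add_cancel x := by
    obtain ⟨t, rfl⟩ := exists_one x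
    change E.map₂ _ (E.map _ _) _ = E.std 0
    rw [← map_const (0 : R) t, E.map_comp]
    simp only [map₂_map, neg_add_cancel]

end ring

/-- The hyperreal numbers `*ℝ` (with `ℝ` lifted to the universe of the standard sets). -/
abbrev Hyperreal : Type w := E.Ext (ULift.{u} ℝ)

/-- The standard real number `r`, seen in `*ℝ`. -/
def real (r : ℝ) : E.Hyperreal := E.std (ULift.up r)

/-- The extended order relations of `*ℝ`. -/
instance : LE E.Hyperreal := ⟨E.Rel (fun a b : ULift.{u} ℝ => a.down ≤ b.down)⟩

instance : LT E.Hyperreal := ⟨E.Rel (fun a b : ULift.{u} ℝ => a.down < b.down)⟩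

/-- The extension `*f : *X → *ℝ` of a real function. -/
def realMap {X : Type u} (f : X → ℝ) : E.Ext X → E.Hyperreal :=
  E.map (fun x => ULift.up (f x))

/-- A hyperreal number `a ≥ 0` is finite if it is bounded by a standard real number
(only used for nonnegative `a`). -/
def IsFin (a : E.Hyperreal) : Prop := ∃ r : ℝ, a ≤ E.real r

/-- A hyperreal number `a ≥ 0` is infinitesimal if it is smaller than every standard positive
real number (only used for nonnegative `a`). -/
def IsInf (a : E.Hyperreal) : Prop := ∀ ε : ℝ, 0 < ε → a < E.real ε

section basic

variable {E}

lemma realMap_le {X : Type u} (f : X → ℝ) (x : E.Ext X) (r : ℝ) :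
    E.realMap f x ≤ E.real r ↔ x ∈ E.setExt {t | f t ≤ r} :=
  rel_map_std (fun a b : ULift.{u} ℝ => a.down ≤ b.down) (fun t => ULift.up (f t)) x (ULift.up r)

lemma realMap_lt {X : Type u} (f : X → ℝ) (x : E.Ext X) (r : ℝ) :
    E.realMap f x < E.real r ↔ x ∈ E.setExt {t | f t < r} :=
  rel_map_std (fun a b : ULift.{u} ℝ => a.down < b.down) (fun t => ULift.up (f t)) x (ULift.up r)

end basic

end NonstandardExtension

/-- The set `V` of all places of the number field `K`: the Archimedean ones and
the non-Archimedean ones. -/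
abbrev NFPlace (K : Type u) [Field K] [NumberField K] : Type u :=
  NumberField.InfinitePlace K ⊕ HeightOneSpectrum (𝓞 K)

/-- The normalised absolute value of a place: `|σ(x)|` for an embedding `σ : K → ℂ`, and
`N(𝔭) ^ (-ord_𝔭 x)` for a maximal ideal `𝔭`. -/
noncomputable def NFPlace.abs {K : Type u} [Field K] [NumberField K] :
    NFPlace K → AbsoluteValue K ℝ
  | .inl v => v.1
  | .inr p => NumberField.HeightOneSpectrum.adicAbv K p

namespace NonstandardExtension

variable (E : NonstandardExtension.{u, w}) (K : Type u) [Field K] [NumberField K]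

/-- The internal absolute value `|·|_v : *K → *ℝ` of a standard place `v`. -/
noncomputable def absV {K : Type u} [Field K] [NumberField K] (v : NFPlace K) :
    E.Ext K → E.Hyperreal :=
  E.realMap (fun x => NFPlace.abs v x)

/-- The uniform structure of `*K`, generated by the entourages
`{(x, y) | |x - y|_v < ε}` for `v ∈ V` and standard `ε > 0`. -/
@[reducible] noncomputable def uniformSpaceV : UniformSpace (E.Ext K) :=
  UniformSpace.ofCore
    { uniformity := ⨅ (v : NFPlace K) (ε : {ε : ℝ // 0 < ε}),
        Filter.principal {p : E.Ext K × E.Ext K | E.absV v (p.1 - p.2) < E.real ε.1}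
      refl := by
        refine le_iInf fun v => le_iInf fun ε => Filter.principal_mono.2 ?_
        rintro ⟨x, y⟩ (rfl : x = y)
        change E.absV v (x - x) < E.real ε.1
        rw [sub_self, absV, realMap_lt]
        refine (E.std_mem_setExt (0 : K) _).2 ?_
        simpa using ε.2
      symm := by
        refine Filter.tendsto_iInf.2 fun v => Filter.tendsto_iInf.2 fun ε =>
          Filter.tendsto_principal.2 ?_
        refine Filter.mem_iInf_of_mem v (Filter.mem_iInf_of_mem ε
          (Filter.mem_principal.2 fun p hp => ?_))
        change E.absV v (p.2 - p.1) < E.real ε.1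
        have hp' : E.absV v (p.1 - p.2) < E.real ε.1 := hp
        rw [absV, realMap_lt] at hp' ⊢
        rw [← neg_sub]
        refine map_mem (f := fun t : K => -t) (fun t ht => ?_) hp'
        simpa using ht
      comp := by
        refine le_iInf fun v => le_iInf fun ε => ?_
        have hmem : {p : E.Ext K × E.Ext K | E.absV v (p.1 - p.2) < E.real (ε.1 / 2)} ∈
            ⨅ (v : NFPlace K) (ε : {ε : ℝ // 0 < ε}),
              Filter.principal {p : E.Ext K × E.Ext K | E.absV v (p.1 - p.2) < E.real ε.1} :=
          Filter.mem_iInf_of_mem v (Filter.mem_iInf_of_mem ⟨ε.1 / 2, half_pos ε.2⟩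
            (Filter.mem_principal.2 (le_refl _)))
        refine (Filter.lift'_le hmem le_rfl).trans (Filter.principal_mono.2 ?_)
        rintro ⟨x, y⟩ ⟨z, h1, h2⟩
        have h1' : E.absV v (x - z) < E.real (ε.1 / 2) := h1
        have h2' : E.absV v (z - y) < E.real (ε.1 / 2) := h2
        change E.absV v (x - y) < E.real ε.1
        rw [absV, realMap_lt] at h1' h2' ⊢
        rw [← sub_add_sub_cancel x z y]
        refine map₂_mem (f := fun a b : K => a + b) (fun a ha b hb => ?_) h1' h2'
        have ha' : NFPlace.abs v a < ε.1 / 2 := ha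
        have hb' : NFPlace.abs v b < ε.1 / 2 := hb
        have := (NFPlace.abs v).add_le a b
        change NFPlace.abs v (a + b) < ε.1
        linarith }

/-- `fin_{V,S}(*K)`: the subring of all `x ∈ *K` which are finite at all places `v ∈ V` and satisfy
`|x|_v ≤ 1` for all non-Archimedean `v ∉ S`. -/
noncomputable def finVS (S : Finset (NFPlace K)) : Subring (E.Ext K) where
  carrier := {x | (∀ v : NFPlace K, E.IsFin (E.absV v x)) ∧
    ∀ p : HeightOneSpectrum (𝓞 K), Sum.inr p ∉ S → E.absV (Sum.inr p) x ≤ E.real 1}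
  zero_mem' := by
    refine ⟨fun v => ⟨0, ?_⟩, fun p _ => ?_⟩
    · rw [absV, realMap_le]
      exact (E.std_mem_setExt (0 : K) _).2 (by simp)
    · rw [absV, realMap_le]
      exact (E.std_mem_setExt (0 : K) _).2 (by simp)
  one_mem' := by
    refine ⟨fun v => ⟨1, ?_⟩, fun p _ => ?_⟩
    · rw [absV, realMap_le]
      exact (E.std_mem_setExt (1 : K) _).2 (by simp)
    · rw [absV, realMap_le]
      exact (E.std_mem_setExt (1 : K) _).2 (by simp)
  add_mem' := by
    rintro x y ⟨hx, hx'⟩ ⟨hy, hy'⟩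
    refine ⟨fun v => ?_, fun p hp => ?_⟩
    · obtain ⟨r, hr⟩ := hx v
      obtain ⟨s, hs⟩ := hy v
      refine ⟨r + s, ?_⟩
      rw [absV, realMap_le] at hr hs ⊢
      refine map₂_mem (f := fun a b : K => a + b) (fun a ha b hb => ?_) hr hs
      exact ((NFPlace.abs v).add_le a b).trans (add_le_add ha hb)
    · have h1 := hx' p hp
      have h2 := hy' p hp
      rw [absV, realMap_le] at h1 h2 ⊢
      refine map₂_mem (f := fun a b : K => a + b) (fun a ha b hb => ?_) h1 h2
      exact (NumberField.HeightOneSpectrum.adicAbv_add_le_max K p a b).trans (max_le ha hb)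
  mul_mem' := by
    rintro x y ⟨hx, hx'⟩ ⟨hy, hy'⟩
    refine ⟨fun v => ?_, fun p hp => ?_⟩
    · obtain ⟨r, hr⟩ := hx v
      obtain ⟨s, hs⟩ := hy v
      refine ⟨r * s, ?_⟩
      rw [absV, realMap_le] at hr hs ⊢
      refine map₂_mem (f := fun a b : K => a * b) (fun a ha b hb => ?_) hr hs
      have ha' : NFPlace.abs v a ≤ r := ha
      change NFPlace.abs v (a * b) ≤ r * s
      rw [map_mul]
      exact mul_le_mul ha' hb ((NFPlace.abs v).nonneg b) (((NFPlace.abs v).nonneg a).trans ha')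
    · have h1 := hx' p hp
      have h2 := hy' p hp
      rw [absV, realMap_le] at h1 h2 ⊢
      refine map₂_mem (f := fun a b : K => a * b) (fun a ha b hb => ?_) h1 h2
      change NFPlace.abs (Sum.inr p) (a * b) ≤ 1
      rw [map_mul]
      exact mul_le_one₀ ha ((NFPlace.abs (Sum.inr p)).nonneg b) hb
  neg_mem' := by
    rintro x ⟨hx, hx'⟩
    refine ⟨fun v => ?_, fun p hp => ?_⟩
    · obtain ⟨r, hr⟩ := hx v
      refine ⟨r, ?_⟩
      rw [absV, realMap_le] at hr ⊢
      refine map_mem (f := fun a : K => -a) (fun a ha => ?_) hr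
      simpa using ha
    · have h1 := hx' p hp
      rw [absV, realMap_le] at h1 ⊢
      refine map_mem (f := fun a : K => -a) (fun a ha => ?_) h1
      simpa using ha

/-- `U_{V,S}(*K) = fin_{V,S}(*K)ˣ`, as a subgroup of `(*K)ˣ`: the units `x` of `*K` such that
`x` and `x⁻¹` belong to `fin_{V,S}(*K)`. -/
noncomputable def unitsVS (S : Finset (NFPlace K)) : Subgroup (E.Ext K)ˣ :=
  (E.finVS K S).toSubmonoid.units

lemma unitsVS_mono {S T : Finset (NFPlace K)} (h : S ⊆ T) : E.unitsVS K S ≤ E.unitsVS K T := by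
  have h' : (E.finVS K S).toSubmonoid ≤ (E.finVS K T).toSubmonoid :=
    fun x hx => ⟨hx.1, fun p hp => hx.2 p fun hS => hp (h hS)⟩
  exact Submonoid.units_mono h'

open scoped Classical in
/-- The underlying group of `U_V(*K)`: the directed union of the groups `U_{V,S}(*K)` over all
finite sets `S` of places. -/
noncomputable def unitsVSubgroup : Subgroup (E.Ext K)ˣ where
  carrier := ⋃ S : Finset (NFPlace K), (E.unitsVS K S : Set (E.Ext K)ˣ)
  one_mem' := Set.mem_iUnion.2 ⟨∅, one_mem _⟩
  mul_mem' := by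
    intro x y hx hy
    obtain ⟨S, hS⟩ := Set.mem_iUnion.1 hx
    obtain ⟨T, hT⟩ := Set.mem_iUnion.1 hy
    exact Set.mem_iUnion.2 ⟨S ∪ T, mul_mem (E.unitsVS_mono K Finset.subset_union_left hS)
      (E.unitsVS_mono K Finset.subset_union_right hT)⟩
  inv_mem' := by
    intro x hx
    obtain ⟨S, hS⟩ := Set.mem_iUnion.1 hx
    exact Set.mem_iUnion.2 ⟨S, inv_mem hS⟩

/-- The group `U_V(*K)`, the direct limit of the groups `U_{V,S}(*K)`. -/
def UnitsV : Type w := E.unitsVSubgroup K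

noncomputable instance : CommGroup (E.UnitsV K) :=
  inferInstanceAs (CommGroup (E.unitsVSubgroup K))

variable {E K} in
/-- The inclusion of `U_V(*K)` in `*K`. -/
def UnitsV.val (x : E.UnitsV K) : E.Ext K := ((x.1 : (E.Ext K)ˣ) : E.Ext K)

/-- The inclusion of `U_{V,S}(*K)` in `U_V(*K)`. -/
def unitsVSIncl (S : Finset (NFPlace K)) (x : E.unitsVS K S) : E.UnitsV K :=
  ⟨x.1, Set.mem_iUnion.2 ⟨S, x.2⟩⟩

/-- The topology of `U_{V,S}(*K)` as a subspace of `*K`. -/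
@[reducible] noncomputable def unitsVSTopology (S : Finset (NFPlace K)) : TopologicalSpace (E.unitsVS K S) :=
  (E.uniformSpaceV K).toTopologicalSpace.induced
    (fun x => ((x.1 : (E.Ext K)ˣ) : E.Ext K))

/-- The final topology of `U_V(*K)` with respect to the inclusions of the `U_{V,S}(*K)`. -/
noncomputable instance : TopologicalSpace (E.UnitsV K) :=
  ⨆ S : Finset (NFPlace K), (E.unitsVSTopology K S).coinduced (E.unitsVSIncl K S)

/-- `inf_V(*K)`: the elements of `*K` which are infinitesimal at all places. -/
def infV : Set (E.Ext K) := {x | ∀ v : NFPlace K, E.IsInf (E.absV v x)}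

/-- `α ∈ 𝔸_K` is the family of the standard parts of `x ∈ *K`: for every place `v`, the hyperreal
number `|x - α_v|_v`, computed in `*(K_v)`, is infinitesimal. (It is the value at `x` of the
extension of the function `K → ℝ`, `y ↦ |y - α_v|_v`.) -/
def IsStandardPart {K : Type u} [Field K] [NumberField K] (x : E.Ext K)
    (α : NumberField.AdeleRing (𝓞 K) K) : Prop :=
  (∀ v : NumberField.InfinitePlace K,
    E.IsInf (E.realMap (fun y : K => ‖(y : v.Completion) - α.1 v‖) x)) ∧
  (∀ p : HeightOneSpectrum (𝓞 K),
    E.IsInf (E.realMap (fun y : K => ‖algebraMap K (p.adicCompletion K) y - α.2 p‖) x))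

end NonstandardExtension

/-!
A point `x` of `*K` is seen by standard functions on `K` through its type, the ultrafilter of all
`A ⊆ K` with `x ∈ *A`, and `α` is the standard part of `x` iff this ultrafilter converges to `α` in
`∏ v, K_v`. Standard parts exist on `U_{V,S}(*K)` because each `K_v` is proper. The topology of
`U_{V,S}(*K)` is therefore the one induced from `∏ v, K_v`, and on the open subgroup of the
ideles that are units outside `S` this is the idele topology. As these open subgroups cover the
ideles, `U_V(*K)` carries the topology induced by `φ`. Surjectivity of `φ` is weak approximation,
which says that `K` is dense in the first countable space `∏ v, K_v`, combined with countable
saturation. The remaining claims hold for every surjective inducing homomorphism onto a locally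
compact Hausdorff group.
-/

open Filter Topology Uniformity NumberField

lemma countable_heightOneSpectrum {R : Type*} [CommRing R] [IsNoetherianRing R] [Countable R] :
    Countable (HeightOneSpectrum R) := by
  choose s hs using fun p : HeightOneSpectrum R => IsNoetherian.noetherian p.asIdeal
  refine Function.Injective.countable (f := s) fun p q hpq => HeightOneSpectrum.ext ?_
  rw [← hs p, ← hs q, hpq]

section DedekindDomain

variable {R : Type*} [CommRing R] [IsDedekindDomain R]
  (K : Type*) [Field K] [Algebra R K] [IsFractionRing R K] (p : HeightOneSpectrum R)

lemma valued_algebraMap_adicCompletion (k : K) :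
    Valued.v (algebraMap K (p.adicCompletion K) k) = p.valuation K k :=
  p.valuedAdicCompletion_eq_valuation' k

lemma exists_valued_algebraMap_sub_lt_one {x : p.adicCompletion K}
    (hx : x ∈ p.adicCompletionIntegers K) :
    ∃ a : R, Valued.v (algebraMap K (p.adicCompletion K) (algebraMap R K a) - x) < 1 := by
  have hball : {y | Valued.v (y - x) < 1} ∈ 𝓝 x :=
    Valued.mem_nhds.2 ⟨1, fun _ hy => (Valuation.restrict_lt_one_iff _).1 hy⟩
  obtain ⟨_, ⟨k, rfl⟩, hkx⟩ := (p.denseRange_algebraMap K).inter_nhds_nonempty hball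
  have hk : p.valuation K k ≤ 1 := by
    rw [← valued_algebraMap_adicCompletion]
    have hx : Valued.v x ≤ 1 := hx
    simpa using Valued.v.map_add_le hkx.le hx
  obtain ⟨a, ha⟩ := p.exists_valuation_sub_lt_of_integer hk 1
  have hak : Valued.v (algebraMap K (p.adicCompletion K) (algebraMap R K a - k)) < 1 :=
    (valued_algebraMap_adicCompletion K p _).trans_lt ha
  refine ⟨a, ?_⟩
  simpa using Valued.v.map_add_lt hak hkx

lemma residue_algebraMap_surjective :
    Function.Surjective ((IsLocalRing.residue (p.adicCompletionIntegers K)).comp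
      (algebraMap R (p.adicCompletionIntegers K))) := by
  intro y
  obtain ⟨x, rfl⟩ := IsLocalRing.residue_surjective y
  obtain ⟨a, ha⟩ := exists_valued_algebraMap_sub_lt_one K p x.2
  refine ⟨a, Ideal.Quotient.eq.2 ?_⟩
  exact (Valuation.mem_maximalIdeal_iff _ _).2 ha

lemma residue_algebraMap_eq_zero {a : R} (ha : a ∈ p.asIdeal) :
    IsLocalRing.residue (p.adicCompletionIntegers K) (algebraMap R _ a) = 0 := by
  refine Ideal.Quotient.eq_zero_iff_mem.2 ((Valuation.mem_maximalIdeal_iff _ _).2 ?_)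
  exact (valued_algebraMap_adicCompletion K p _).trans_lt ((p.valuation_lt_one_iff_mem a).2 ha)

lemma finite_residueField_adicCompletionIntegers [Finite (R ⧸ p.asIdeal)] :
    Finite (IsLocalRing.ResidueField (p.adicCompletionIntegers K)) :=
  .of_surjective _ <| Ideal.Quotient.lift_surjective_of_surjective p.asIdeal
    (fun _ ha => residue_algebraMap_eq_zero K p ha) (residue_algebraMap_surjective K p)

end DedekindDomain

section NumberField

variable (K : Type u) [Field K] [NumberField K]

instance properSpace_infinitePlaceCompletion (v : InfinitePlace K) :
    ProperSpace v.Completion :=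
  have h := InfinitePlace.Completion.isometry_extensionEmbedding v
  ⟨fun x r => h.preimage_closedBall x r ▸
    h.isClosedEmbedding.isCompact_preimage (isCompact_closedBall _ _)⟩

instance properSpace_adicCompletion (p : HeightOneSpectrum (𝓞 K)) :
    ProperSpace (p.adicCompletion K) :=
  have := p.asIdeal.finiteQuotientOfFreeOfNeBot p.ne_bot
  Valued.integer.properSpace_iff_completeSpace_and_isDiscreteValuationRing_integer_and_finite_residueField.2
    ⟨inferInstance, inferInstanceAs (IsDiscreteValuationRing (p.adicCompletionIntegers K)),
      finite_residueField_adicCompletionIntegers K p⟩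

instance compactSpace_adicCompletionIntegers (p : HeightOneSpectrum (𝓞 K)) :
    CompactSpace (p.adicCompletionIntegers K) :=
  Valued.integer.properSpace_iff_compactSpace_integer.1 (properSpace_adicCompletion K p)

instance countable_nfPlace : Countable (NFPlace K) :=
  have : Countable K := (Module.finBasis ℚ K).equivFun.injective.countable
  have : Countable (𝓞 K) := RingOfIntegers.coe_injective.countable
  have := countable_heightOneSpectrum (R := 𝓞 K)
  inferInstance

end NumberField

lemma denseRange_pi_of_finset {X ι : Type*} {Y : ι → Type*} [∀ i, TopologicalSpace (Y i)]
    {f : X → ∀ i, Y i} (hf : ∀ T : Finset ι, DenseRange fun x => T.restrict (f x)) :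
    DenseRange f := by
  refine dense_iff_inter_open.2 fun U hU ⟨y, hy⟩ => ?_
  obtain ⟨T, u, hu, hTU⟩ := isOpen_pi_iff.1 hU y hy
  obtain ⟨x, hx⟩ := (hf T).exists_mem_open
    (isOpen_set_pi Set.finite_univ fun i _ => (hu i.1 i.2).1)
    ⟨T.restrict y, fun i _ => (hu i.1 i.2).2⟩
  exact ⟨f x, hTU fun i hi => hx ⟨i, hi⟩ trivial, x, rfl⟩

namespace NFPlace

variable {K : Type u} [Field K] [NumberField K]

/-- The completion `K_v` of `K` at a place `v`, in a form uniform in the Archimedean and the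
non-Archimedean places. -/
def Completion : NFPlace K → Type u
  | .inl v => v.Completion
  | .inr p => p.adicCompletion K

noncomputable instance : ∀ v : NFPlace K, NormedField v.Completion
  | .inl v => inferInstanceAs (NormedField v.Completion)
  | .inr p => inferInstanceAs (NormedField (p.adicCompletion K))

noncomputable instance : ∀ v : NFPlace K, Algebra K v.Completion
  | .inl v => inferInstanceAs (Algebra K v.Completion)
  | .inr p => inferInstanceAs (Algebra K (p.adicCompletion K))

instance : ∀ v : NFPlace K, ProperSpace v.Completion
  | .inl v => inferInstanceAs (ProperSpace v.Completion)
  | .inr p => inferInstanceAs (ProperSpace (p.adicCompletion K))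

lemma norm_algebraMap : ∀ (v : NFPlace K) (t : K), ‖algebraMap K v.Completion t‖ = v.abs t
  | .inl v, t => InfinitePlace.Completion.norm_coe v (WithAbs.toAbs v.1 t)
  | .inr p, t => FinitePlace.norm_embedding p t

lemma denseRange_algebraMap : ∀ v : NFPlace K, DenseRange (algebraMap K v.Completion)
  | .inl v => (InfinitePlace.Completion.denseRange_coe v).comp
      (WithAbs.equiv v.1).symm.surjective.denseRange
      (InfinitePlace.Completion.continuous_coe v)
  | .inr p => p.denseRange_algebraMap K

lemma abs_inr_coe_le_one (p : HeightOneSpectrum (𝓞 K)) (a : 𝓞 K) :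
    NFPlace.abs (.inr p) (a : K) ≤ 1 :=
  p.adicAbv_coe_le_one (NumberField.HeightOneSpectrum.one_lt_absNorm_nnreal p) a

lemma abs_inr_coe_lt_one_iff (p : HeightOneSpectrum (𝓞 K)) (a : 𝓞 K) :
    NFPlace.abs (.inr p) (a : K) < 1 ↔ a ∈ p.asIdeal :=
  p.adicAbv_coe_lt_one_iff (NumberField.HeightOneSpectrum.one_lt_absNorm_nnreal p) a

lemma abs_isNontrivial : ∀ v : NFPlace K, v.abs.IsNontrivial
  | .inl v => v.isNontrivial
  | .inr p => by
    obtain ⟨a, ha, h0⟩ := Submodule.exists_mem_ne_zero_of_ne_bot p.ne_bot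
    exact ⟨a, by simpa using h0, ((abs_inr_coe_lt_one_iff p a).2 ha).ne⟩

lemma not_isEquiv_abs_inl_inr (v : InfinitePlace K) (p : HeightOneSpectrum (𝓞 K)) :
    ¬ (NFPlace.abs (.inl v)).IsEquiv (NFPlace.abs (.inr p)) := by
  intro h
  have hp : NFPlace.abs (.inl v) ((2 : ℕ) : K) ≤ 1 := by
    simpa only [map_natCast, h.le_one_iff] using abs_inr_coe_le_one p (2 : ℕ)
  have hv : NFPlace.abs (.inl v) ((2 : ℕ) : K) = 2 := v.map_natCast 2
  linarith

lemma abs_pairwise_not_isEquiv :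
    Pairwise fun v w : NFPlace K => ¬ v.abs.IsEquiv w.abs := by
  rintro (v | p) (w | q) hne h
  · exact hne (congrArg Sum.inl (InfinitePlace.eq_iff_isEquiv.2 h))
  · exact not_isEquiv_abs_inl_inr v q h
  · exact not_isEquiv_abs_inl_inr w p h.symm
  · refine hne (congrArg Sum.inr (HeightOneSpectrum.ext (Ideal.ext fun a => ?_)))
    rw [← abs_inr_coe_lt_one_iff, ← abs_inr_coe_lt_one_iff, h.lt_one_iff]

lemma continuous_algebraMap_ofAbs (v : NFPlace K) :
    Continuous fun t : WithAbs v.abs => algebraMap K v.Completion t.ofAbs :=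
  (AddMonoidHomClass.isometry_of_norm
    ((algebraMap K v.Completion).comp (WithAbs.equiv v.abs).toRingHom)
    fun t => norm_algebraMap v t.ofAbs).continuous

lemma denseRange_algebraMap_pi : DenseRange (algebraMap K (∀ v : NFPlace K, v.Completion)) := by
  refine denseRange_pi_of_finset fun T => ?_
  have hK : DenseRange (algebraMap K (∀ v : T, WithAbs v.1.abs)) :=
    AbsoluteValue.denseRange_algebraMap_pi (fun v => abs_isNontrivial v.1)
      fun _ _ hvw => abs_pairwise_not_isEquiv fun h => hvw (Subtype.ext h)
  have hT : DenseRange (Pi.map fun (v : T) (t : WithAbs v.1.abs) =>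
      algebraMap K v.1.Completion t.ofAbs) :=
    .piMap fun v => (congrArg Dense ((WithAbs.equiv v.1.abs).surjective.range_comp _)).mpr
      (denseRange_algebraMap v.1)
  exact hT.comp hK (continuous_pi fun v =>
    (continuous_algebraMap_ofAbs v.1).comp (continuous_apply v))

end NFPlace

section Ideles

variable {K : Type u} [Field K] [NumberField K]

/-- The family of the coordinates of an adele at all places. -/
def adeleCoords : AdeleRing (𝓞 K) K →+* ∀ v : NFPlace K, v.Completion where
  toFun α
    | .inl v => α.1 v
    | .inr p => α.2 p
  map_zero' := by ext (v | p) <;> rfl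
  map_one' := by ext (v | p) <;> rfl
  map_add' α β := by ext (v | p) <;> rfl
  map_mul' α β := by ext (v | p) <;> rfl

lemma adeleCoords_injective : Function.Injective (adeleCoords (K := K)) := fun _ _ h =>
  Prod.ext (funext fun v => congrFun h (.inl v))
    (FiniteAdeleRing.ext K fun p => congrFun h (.inr p))

lemma continuous_adeleCoords : Continuous (adeleCoords (K := K)) :=
  continuous_pi fun
    | .inl v => (continuous_apply v).comp continuous_fst
    | .inr p => (RestrictedProduct.continuous_eval p).comp continuous_snd

instance : T2Space (AdeleRing (𝓞 K) K) :=
  .of_injective_continuous adeleCoords_injective continuous_adeleCoords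

instance : LocallyCompactSpace (FiniteAdeleRing (𝓞 K) K) :=
  haveI : Fact (∀ p : HeightOneSpectrum (𝓞 K),
      IsOpen (p.adicCompletionIntegers K : Set (p.adicCompletion K))) :=
    ⟨fun _ => Valued.isOpen_valuationSubring _⟩
  inferInstanceAs (LocallyCompactSpace (RestrictedProduct
    (fun p : HeightOneSpectrum (𝓞 K) => p.adicCompletion K)
    (fun p => (p.adicCompletionIntegers K : Set (p.adicCompletion K))) cofinite))

instance : LocallyCompactSpace (AdeleRing (𝓞 K) K)ˣ :=
  haveI : LocallyCompactSpace (AdeleRing (𝓞 K) K) :=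
    inferInstanceAs (LocallyCompactSpace (InfiniteAdeleRing K × FiniteAdeleRing (𝓞 K) K))
  Units.isClosedEmbedding_embedProduct.locallyCompactSpace

/-- The ring `A_{K,S}` of the adeles which are integral at all finite places outside `S`. -/
def adelesS (S : Finset (NFPlace K)) : Subring (AdeleRing (𝓞 K) K) where
  carrier := {α | ∀ p, Sum.inr p ∉ S → α.2 p ∈ p.adicCompletionIntegers K}
  zero_mem' _ _ := zero_mem _
  one_mem' _ _ := one_mem _
  add_mem' hα hβ p hp := add_mem (hα p hp) (hβ p hp)
  mul_mem' hα hβ p hp := mul_mem (hα p hp) (hβ p hp)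
  neg_mem' hα p hp := neg_mem (hα p hp)

lemma isOpen_adelesS (S : Finset (NFPlace K)) : IsOpen (adelesS S : Set (AdeleRing (𝓞 K) K)) :=
  (RestrictedProduct.isOpen_forall_imp_mem
    (A := fun p : HeightOneSpectrum (𝓞 K) =>
      (p.adicCompletionIntegers K : Set (p.adicCompletion K)))
    fun _ => Valued.isOpen_valuationSubring _).preimage
    (continuous_snd : Continuous fun α : AdeleRing (𝓞 K) K => α.2)

lemma adelesS_mono : Monotone (adelesS (K := K)) := fun _ _ h _ hα p hp => hα p fun hS => hp (h hS)

lemma exists_mem_adelesS (α : AdeleRing (𝓞 K) K) : ∃ S : Finset (NFPlace K), α ∈ adelesS S := by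
  have hα : {p | α.2 p ∉ p.adicCompletionIntegers K}.Finite := α.2.2
  refine ⟨hα.toFinset.map .inr, fun p hp => ?_⟩
  simpa using hp

lemma eventually_cofinite_inr_notMem (S : Finset (NFPlace K)) :
    ∀ᶠ p : HeightOneSpectrum (𝓞 K) in cofinite, Sum.inr p ∉ S :=
  Sum.inr_injective.tendsto_cofinite.eventually S.eventually_cofinite_notMem

lemma norm_le_one_iff_mem_adicCompletionIntegers {p : HeightOneSpectrum (𝓞 K)}
    {x : p.adicCompletion K} : ‖x‖ ≤ 1 ↔ x ∈ p.adicCompletionIntegers K :=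
  Valued.toNormedField.norm_le_one_iff

lemma exists_adeleCoords_eq {S : Finset (NFPlace K)}
    (a : ∀ v : NFPlace K, v.Completion)
    (ha : ∀ p : HeightOneSpectrum (𝓞 K), Sum.inr p ∉ S → ‖a (.inr p)‖ ≤ 1) :
    ∃ α, adeleCoords α = a := by
  refine ⟨(fun v => a (.inl v), ⟨fun p => a (.inr p), ?_⟩), by ext (v | p) <;> rfl⟩
  exact (eventually_cofinite_inr_notMem S).mono fun p hp =>
    norm_le_one_iff_mem_adicCompletionIntegers.1 (ha p hp)

section

variable {Y : Type*} [TopologicalSpace Y] {S : Finset (NFPlace K)}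

lemma continuous_of_mem_adelesS {α : Y → AdeleRing (𝓞 K) K} (hS : ∀ y, α y ∈ adelesS S)
    (hα : Continuous fun y => adeleCoords (α y)) : Continuous α := by
  let β : Y → RestrictedProduct (fun p : HeightOneSpectrum (𝓞 K) => p.adicCompletion K)
      (fun p => (p.adicCompletionIntegers K : Set (p.adicCompletion K)))
      (𝓟 {p | Sum.inr p ∉ S}) :=
    fun y => ⟨(α y).2, eventually_principal.2 (hS y)⟩
  have hβ : Continuous β := RestrictedProduct.continuous_rng_of_principal_iff_forall.2
    fun p => (continuous_apply (Sum.inr p)).comp hα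
  exact (continuous_pi fun v => (continuous_apply (Sum.inl v)).comp hα).prodMk
    ((RestrictedProduct.continuous_inclusion
      (le_principal_iff.2 (eventually_cofinite_inr_notMem S))).comp hβ)

end

/-- The group `A_{K,S}ˣ` of the ideles which are units at all finite places outside `S`. -/
noncomputable def idelesS (S : Finset (NFPlace K)) : Subgroup (AdeleRing (𝓞 K) K)ˣ :=
  (adelesS S).toSubmonoid.units

lemma isOpen_idelesS (S : Finset (NFPlace K)) :
    IsOpen (idelesS S : Set (AdeleRing (𝓞 K) K)ˣ) :=
  ((isOpen_adelesS S).preimage Units.continuous_val).inter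
    ((isOpen_adelesS S).preimage Units.continuous_coe_inv)

open scoped Classical in
lemma exists_mem_idelesS (a : (AdeleRing (𝓞 K) K)ˣ) :
    ∃ S : Finset (NFPlace K), a ∈ idelesS S := by
  obtain ⟨S, hS⟩ := exists_mem_adelesS a.val
  obtain ⟨T, hT⟩ := exists_mem_adelesS a.inv
  exact ⟨S ∪ T, adelesS_mono Finset.subset_union_left hS,
    adelesS_mono Finset.subset_union_right hT⟩

lemma adeleCoords_unit_ne_zero (a : (AdeleRing (𝓞 K) K)ˣ) (v : NFPlace K) :
    adeleCoords a.val v ≠ 0 :=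
  ((a.isUnit.map adeleCoords).map (Pi.evalRingHom _ v)).ne_zero

lemma adeleCoords_inv (a : (AdeleRing (𝓞 K) K)ˣ) :
    adeleCoords a⁻¹.val = (adeleCoords a.val)⁻¹ := by
  ext v
  exact eq_inv_of_mul_eq_one_right (by rw [← Pi.mul_apply, ← map_mul, a.mul_inv, map_one]; rfl)

lemma induced_adeleCoords_eq_of_mem_idelesS {Y : Type*} {S : Finset (NFPlace K)}
    {a : Y → (AdeleRing (𝓞 K) K)ˣ} (hS : ∀ y, a y ∈ idelesS S) :
    TopologicalSpace.induced (fun y => adeleCoords (a y).val) inferInstance =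
      TopologicalSpace.induced a inferInstance := by
  refine le_antisymm ?_ ?_
  · let := TopologicalSpace.induced (fun y => adeleCoords (a y).val) inferInstance
    have hc : Continuous fun y => adeleCoords (a y).val := continuous_induced_dom
    have hc' : Continuous fun y => adeleCoords (a y)⁻¹.val := by
      simp only [adeleCoords_inv]
      exact continuous_pi fun v => ((continuous_apply v).comp hc).inv₀
        fun y => adeleCoords_unit_ne_zero (a y) v
    exact (Units.continuous_iff.2 ⟨continuous_of_mem_adelesS (fun y => (hS y).1) hc,
      continuous_of_mem_adelesS (fun y => (hS y).2) hc'⟩).le_induced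
  · let := TopologicalSpace.induced a inferInstance
    exact (continuous_adeleCoords.comp
      (Units.continuous_val.comp continuous_induced_dom)).le_induced

end Ideles

namespace NonstandardExtension

variable {E : NonstandardExtension.{u, w}}

section Types

variable {X Y Z : Type u}

lemma setExt_univ : E.setExt (Set.univ : Set X) = Set.univ := by
  refine Set.eq_univ_of_forall fun x => by_contra fun hx => hx (setExt_mono (Set.subset_univ ∅ᶜ) ?_)
  rw [E.setExt_compl]
  exact fun h => hx (setExt_mono (Set.empty_subset _) h)

/-- The type of a point `x ∈ *X`: the ultrafilter of all sets `A ⊆ X` such that `x ∈ *A`. It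
transports the limits of functions on `X` to the points of `*X`. -/
def type (x : E.Ext X) : Ultrafilter X :=
  Ultrafilter.ofComplNotMemIff
    { sets := {A | x ∈ E.setExt A}
      univ_sets := setExt_univ.ge trivial
      sets_of_superset := fun h hAB => setExt_mono hAB h
      inter_sets := fun {A B} hA hB => (E.setExt_inter A B).ge ⟨hA, hB⟩ }
    fun A => (E.setExt_compl A ▸ not_not : ¬ x ∈ E.setExt Aᶜ ↔ x ∈ E.setExt A)

lemma mem_type {x : E.Ext X} {A : Set X} : A ∈ type x ↔ x ∈ E.setExt A := Iff.rfl

lemma type_map (f : X → Y) (x : E.Ext X) : type (E.map f x) = (type x).map f := by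
  ext A
  rw [Ultrafilter.mem_map, mem_type, mem_type, E.setExt_preimage, Set.mem_preimage]

lemma tendsto_type_map {F : Type*} {f : X → Y} {x : E.Ext X} {g : Y → F} {l : Filter F} :
    Tendsto g (type (E.map f x)) l ↔ Tendsto (g ∘ f) (type x) l := by
  rw [type_map, Ultrafilter.coe_map, tendsto_map'_iff]

lemma tendsto_type_map₂ {F G H : Type*} [TopologicalSpace F] [TopologicalSpace G]
    [TopologicalSpace H] {f : X → F} {g : Y → G} {h : Z → H} {m : X → Y → Z} {n : F → G → H}
    (hmn : ∀ s t, h (m s t) = n (f s) (g t)) {x : E.Ext X} {y : E.Ext Y} {a : F} {b : G}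
    (hn : ContinuousAt (Function.uncurry n) (a, b))
    (hx : Tendsto f (type x) (𝓝 a)) (hy : Tendsto g (type y) (𝓝 b)) :
    Tendsto h (type (E.map₂ m x y)) (𝓝 (n a b)) := by
  obtain ⟨t, rfl, rfl⟩ := exists_two x y
  rw [map₂_map, tendsto_type_map]
  rw [tendsto_type_map] at hx hy
  exact (hn.tendsto.comp (hx.prodMk_nhds hy)).congr fun _ => (hmn _ _).symm

lemma tendsto_type_std {F : Type*} [TopologicalSpace F] (g : X → F) (x : X) :
    Tendsto g (type (E.std x)) (𝓝 (g x)) :=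
  tendsto_nhds.2 fun s _ hs => (E.std_mem_setExt x (g ⁻¹' s)).2 hs

lemma map_eq_map_of_eventually_eq {f g : X → Y} {x : E.Ext X}
    (h : ∀ᶠ t in (type x : Filter X), f t = g t) : E.map f x = E.map g x := by
  have hfg : E.map (fun t => (f t, g t)) x ∈ E.setExt {p : Y × Y | p.1 = p.2} := by
    rwa [← Set.mem_preimage, ← E.setExt_preimage]
  rw [E.setExt_diagonal, Set.mem_ofPred_eq] at hfg
  rwa [E.map_comp, E.map_comp] at hfg

lemma isInternal_setExt (A : Set X) : E.IsInternal (E.setExt A) := by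
  refine ⟨E.std A, Set.ext fun x => ?_⟩
  have h := rel_map_std (E := E) (fun (t : X) (B : Set X) => t ∈ B) (fun t : X => t) x A
  rw [E.map_id] at h
  exact h.symm

lemma CountablySaturated.exists_type_le (hE : E.CountablySaturated) (l : Filter X)
    [l.IsCountablyGenerated] [l.NeBot] : ∃ x : E.Ext X, (type x : Filter X) ≤ l := by
  obtain ⟨B, hB⟩ := l.exists_antitone_basis
  obtain ⟨x, hx⟩ := hE X (fun n => E.setExt (B n)) (fun _ => isInternal_setExt _) fun F => by
    obtain ⟨t, ht⟩ := l.nonempty_of_mem ((biInter_finset_mem F).2 fun n _ => hB.mem n)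
    exact ⟨E.std t, Set.mem_iInter₂.2 fun n hn =>
      (E.std_mem_setExt t _).2 (Set.mem_iInter₂.1 ht n hn)⟩
  exact ⟨x, hB.ge_iff.2 fun n _ => Set.mem_iInter.1 hx n⟩

lemma realMap_le_iff {f : X → ℝ} {x : E.Ext X} {r : ℝ} :
    E.realMap f x ≤ E.real r ↔ ∀ᶠ t in (type x : Filter X), f t ≤ r := realMap_le f x r

lemma realMap_lt_iff {f : X → ℝ} {x : E.Ext X} {r : ℝ} :
    E.realMap f x < E.real r ↔ ∀ᶠ t in (type x : Filter X), f t < r := realMap_lt f x r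

lemma isInf_realMap_norm_sub_iff {F : Type*} [SeminormedAddCommGroup F] {f : X → F} {a : F}
    {x : E.Ext X} : E.IsInf (E.realMap (fun t => ‖f t - a‖) x) ↔ Tendsto f (type x) (𝓝 a) := by
  simp only [IsInf, realMap_lt_iff, Metric.tendsto_nhds, dist_eq_norm, gt_iff_lt]

lemma exists_tendsto_type {F : Type*} [SeminormedAddCommGroup F] [ProperSpace F]
    {f : X → F} {x : E.Ext X} {r : ℝ} (h : ∀ᶠ t in (type x : Filter X), ‖f t‖ ≤ r) :
    ∃ a, Tendsto f (type x) (𝓝 a) := by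
  obtain ⟨a, -, ha⟩ := (isCompact_closedBall (0 : F) r).ultrafilter_le_nhds ((type x).map f)
    (le_principal_iff.2 (h.mono fun _ ht => mem_closedBall_zero_iff.2 ht))
  exact ⟨a, ha⟩

end Types

section Ring

variable {R : Type u} [CommRing R] {F : Type*} [Ring F] [TopologicalSpace F] (f : R →+* F)
  {x y : E.Ext R} {a b : F}

lemma tendsto_type_mul [ContinuousMul F] (hx : Tendsto f (type x) (𝓝 a))
    (hy : Tendsto f (type y) (𝓝 b)) : Tendsto f (type (x * y)) (𝓝 (a * b)) :=
  tendsto_type_map₂ (map_mul f) continuous_mul.continuousAt hx hy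

lemma tendsto_type_add [ContinuousAdd F] (hx : Tendsto f (type x) (𝓝 a))
    (hy : Tendsto f (type y) (𝓝 b)) : Tendsto f (type (x + y)) (𝓝 (a + b)) :=
  tendsto_type_map₂ (map_add f) continuous_add.continuousAt hx hy

lemma tendsto_type_neg [ContinuousNeg F] (hx : Tendsto f (type x) (𝓝 a)) :
    Tendsto f (type (-x)) (𝓝 (-a)) :=
  tendsto_type_map.2 (hx.neg.congr fun t => (map_neg f t).symm)

lemma tendsto_type_sub [IsTopologicalAddGroup F] (hx : Tendsto f (type x) (𝓝 a))
    (hy : Tendsto f (type y) (𝓝 b)) : Tendsto f (type (x - y)) (𝓝 (a - b)) := by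
  rw [sub_eq_add_neg, sub_eq_add_neg]
  exact tendsto_type_add f hx (tendsto_type_neg f hy)

lemma tendsto_type_one : Tendsto f (type (1 : E.Ext R)) (𝓝 1) := by
  rw [← map_one f]
  exact tendsto_type_std f 1

lemma tendsto_type_sub_one_iff [IsTopologicalAddGroup F] :
    Tendsto f (type (x - 1)) (𝓝 0) ↔ Tendsto f (type x) (𝓝 1) :=
  ⟨fun h => by simpa using tendsto_type_add f h (tendsto_type_one f),
    fun h => by simpa using tendsto_type_sub f h (tendsto_type_one f)⟩

end Ring

lemma mul_map_inv_cancel {k : Type u} [Field k] {x : E.Ext k}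
    (hx : ∀ᶠ t in (type x : Filter k), t ≠ 0) : x * E.map (fun t => t⁻¹) x = 1 := calc
  x * E.map (fun t => t⁻¹) x = E.map (fun t => t) x * E.map (fun t => t⁻¹) x := by rw [E.map_id]
  _ = E.map (fun t => t * t⁻¹) x := map₂_map _ _ _ _
  _ = E.map (fun _ => 1) x :=
    map_eq_map_of_eventually_eq (hx.mono fun _ ht => mul_inv_cancel₀ ht)
  _ = 1 := map_const _ _

end NonstandardExtension

namespace NonstandardExtension

variable {E : NonstandardExtension.{u, w}} {K : Type u} [Field K] [NumberField K]

section StandardPart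

variable {x y : E.Ext K} {α β : AdeleRing (𝓞 K) K} {S : Finset (NFPlace K)}

lemma isStandardPart_iff : E.IsStandardPart x α ↔
    Tendsto (algebraMap K (∀ v : NFPlace K, v.Completion)) (type x) (𝓝 (adeleCoords α)) := by
  rw [tendsto_pi_nhds, Sum.forall]
  exact and_congr (forall_congr' fun _ => isInf_realMap_norm_sub_iff)
    (forall_congr' fun _ => isInf_realMap_norm_sub_iff)

lemma IsStandardPart.unique (hα : E.IsStandardPart x α) (hβ : E.IsStandardPart x β) : α = β :=
  adeleCoords_injective (tendsto_nhds_unique (isStandardPart_iff.1 hα) (isStandardPart_iff.1 hβ))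

lemma IsStandardPart.mul (hα : E.IsStandardPart x α) (hβ : E.IsStandardPart y β) :
    E.IsStandardPart (x * y) (α * β) := by
  rw [isStandardPart_iff] at hα hβ ⊢
  rw [map_mul]
  exact tendsto_type_mul _ hα hβ

lemma isStandardPart_one : E.IsStandardPart (1 : E.Ext K) 1 := by
  rw [isStandardPart_iff, map_one]
  exact tendsto_type_one _

lemma mem_infV_iff : x ∈ E.infV K ↔
    Tendsto (algebraMap K (∀ v : NFPlace K, v.Completion)) (type x) (𝓝 0) := by
  rw [tendsto_pi_nhds]
  refine forall_congr' fun v => ?_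
  rw [← isInf_realMap_norm_sub_iff]
  simp only [Pi.algebraMap_apply, Pi.zero_apply, sub_zero, NFPlace.norm_algebraMap]
  rfl

lemma isStandardPart_one_iff : E.IsStandardPart x 1 ↔ x - 1 ∈ E.infV K := by
  rw [isStandardPart_iff, map_one, mem_infV_iff, tendsto_type_sub_one_iff]

lemma mem_finVS_iff : x ∈ E.finVS K S ↔
    (∀ v : NFPlace K, ∃ r, ∀ᶠ t in (type x : Filter K), ‖algebraMap K v.Completion t‖ ≤ r) ∧
      ∀ p, Sum.inr p ∉ S → ∀ᶠ t in (type x : Filter K),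
        ‖algebraMap K (NFPlace.Completion (.inr p)) t‖ ≤ 1 := by
  simp only [NFPlace.norm_algebraMap, ← realMap_le_iff]
  rfl

lemma exists_isStandardPart (hx : x ∈ E.finVS K S) : ∃ α, E.IsStandardPart x α := by
  obtain ⟨hfin, hint⟩ := mem_finVS_iff.1 hx
  have hlim v : ∃ a, Tendsto (algebraMap K (NFPlace.Completion v)) (type x) (𝓝 a) :=
    exists_tendsto_type (hfin v).choose_spec
  choose a ha using hlim
  obtain ⟨α, hα⟩ := exists_adeleCoords_eq a fun p hp => le_of_tendsto (ha _).norm (hint p hp)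
  exact ⟨α, isStandardPart_iff.2 (hα ▸ tendsto_pi_nhds.2 ha)⟩

lemma IsStandardPart.mem_finVS_iff (h : E.IsStandardPart x α) :
    x ∈ E.finVS K S ↔ α ∈ adelesS S := by
  have hlim := tendsto_pi_nhds.1 (isStandardPart_iff.1 h)
  rw [NonstandardExtension.mem_finVS_iff]
  refine ⟨fun ⟨_, hint⟩ p hp => norm_le_one_iff_mem_adicCompletionIntegers.1
    (le_of_tendsto (hlim (.inr p)).norm (hint p hp)), fun hα => ⟨fun v =>
    (hlim v).norm.isBoundedUnder_le.eventually_le, fun p hp => ?_⟩⟩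
  have hopen : IsOpen (p.adicCompletionIntegers K : Set (p.adicCompletion K)) :=
    Valued.isOpen_valuationSubring _
  exact ((hlim (.inr p)).eventually (hopen.mem_nhds (hα p hp))).mono
    fun t ht => norm_le_one_iff_mem_adicCompletionIntegers.2 ht

variable {a : (AdeleRing (𝓞 K) K)ˣ}

lemma IsStandardPart.eventually_ne_zero (h : E.IsStandardPart x a.val) :
    ∀ᶠ t in (type x : Filter K), t ≠ 0 := by
  obtain ⟨v⟩ : Nonempty (InfinitePlace K) := inferInstance
  have hv := tendsto_pi_nhds.1 (isStandardPart_iff.1 h) (.inl v)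
  exact (hv.eventually_ne (adeleCoords_unit_ne_zero a _)).mono fun t ht ht' =>
    ht (ht' ▸ map_zero (algebraMap K (NFPlace.Completion (.inl v))))

lemma IsStandardPart.map_inv (h : E.IsStandardPart x a.val) :
    E.IsStandardPart (E.map (fun t => t⁻¹) x) a⁻¹.val := by
  rw [isStandardPart_iff, tendsto_type_map, adeleCoords_inv, tendsto_pi_nhds]
  intro v
  have hv := tendsto_pi_nhds.1 (isStandardPart_iff.1 h) v
  exact (hv.inv₀ (adeleCoords_unit_ne_zero a v)).congr fun t =>
    (map_inv₀ (algebraMap K (NFPlace.Completion v)) t).symm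

end StandardPart

section Topology

variable {x y : E.Ext K} {v : NFPlace K} {a b : v.Completion} {r : ℝ}

lemma absV_sub_lt_of_dist_lt (hx : Tendsto (algebraMap K v.Completion) (type x) (𝓝 a))
    (hy : Tendsto (algebraMap K v.Completion) (type y) (𝓝 b)) (h : dist a b < r) :
    E.absV v (x - y) < E.real r := by
  rw [dist_eq_norm] at h
  rw [absV, realMap_lt_iff]
  simpa only [NFPlace.norm_algebraMap] using
    (tendsto_type_sub _ hx hy).norm.eventually_lt_const h

lemma dist_le_of_absV_sub_lt (hx : Tendsto (algebraMap K v.Completion) (type x) (𝓝 a))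
    (hy : Tendsto (algebraMap K v.Completion) (type y) (𝓝 b)) (h : E.absV v (x - y) < E.real r) :
    dist a b ≤ r := by
  rw [dist_eq_norm]
  rw [absV, realMap_lt_iff] at h
  exact le_of_tendsto (tendsto_type_sub _ hx hy).norm
    (h.mono fun t ht => (NFPlace.norm_algebraMap v t).trans_le ht.le)

lemma comap_uniformSpaceV_eq {Y : Type*} {i : Y → E.Ext K} {a : Y → ∀ v : NFPlace K, v.Completion}
    (ha : ∀ y, Tendsto (algebraMap K (∀ v : NFPlace K, v.Completion)) (type (i y)) (𝓝 (a y))) :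
    (E.uniformSpaceV K).comap i = .comap a inferInstance := by
  simp only [tendsto_pi_nhds] at ha
  refine UniformSpace.ext ?_
  change comap _ (⨅ (v : NFPlace K) (ε : {ε : ℝ // 0 < ε}),
    𝓟 {p : E.Ext K × E.Ext K | E.absV v (p.1 - p.2) < E.real ε.1}) = comap _ (𝓤 _)
  simp only [Pi.uniformity, PseudoMetricSpace.uniformity_dist, comap_iInf, comap_principal,
    iInf_subtype]
  refine iInf_congr fun v => le_antisymm ?_ ?_
  · refine le_iInf₂ fun ε hε => iInf₂_le_of_le (ε / 2) (half_pos hε) (principal_mono.2 ?_)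
    exact fun p hp => (dist_le_of_absV_sub_lt (ha _ v) (ha _ v) hp).trans_lt (half_lt_self hε)
  · refine iInf₂_mono fun ε _ => principal_mono.2 ?_
    exact fun p hp => absV_sub_lt_of_dist_lt (ha _ v) (ha _ v) hp

lemma induced_uniformSpaceV_eq {Y : Type*} {i : Y → E.Ext K}
    {a : Y → ∀ v : NFPlace K, v.Completion}
    (ha : ∀ y, Tendsto (algebraMap K (∀ v : NFPlace K, v.Completion)) (type (i y)) (𝓝 (a y))) :
    (E.uniformSpaceV K).toTopologicalSpace.induced i = .induced a inferInstance :=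
  congrArg (@UniformSpace.toTopologicalSpace Y) (comap_uniformSpaceV_eq ha)

end Topology

end NonstandardExtension

lemma iSup_coinduced_induced_comp {ι X Y : Type*} {Z : ι → Type*} [t : TopologicalSpace Y]
    {f : X → Y} {O : ι → Set Y} (hO : ∀ s, IsOpen (O s)) (hcover : ∀ y, ∃ s, y ∈ O s)
    {i : ∀ s, Z s → X} (hi : ∀ s, Set.range (i s) = f ⁻¹' O s) :
    ⨆ s, (t.induced (f ∘ i s)).coinduced (i s) = t.induced f := by
  refine le_antisymm (iSup_le fun s => ?_) fun U hU => ?_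
  · rw [coinduced_le_iff_le_induced, induced_compose]
  · have hU' s : ∃ V, IsOpen V ∧ (f ∘ i s) ⁻¹' V = i s ⁻¹' U :=
      isOpen_induced_iff.1 (isOpen_coinduced.1 (isOpen_iSup_iff.1 hU s))
    choose V hV hVU using hU'
    refine isOpen_induced_iff.2 ⟨⋃ s, V s ∩ O s, isOpen_iUnion fun s => (hV s).inter (hO s), ?_⟩
    have hmem {s x} (hx : f x ∈ O s) : f x ∈ V s ↔ x ∈ U := by
      obtain ⟨z, rfl⟩ := (hi s).ge hx
      exact Set.ext_iff.1 (hVU s) z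
    ext x
    simp only [Set.mem_preimage, Set.mem_iUnion, Set.mem_inter_iff]
    refine ⟨fun ⟨s, hxV, hxO⟩ => (hmem hxO).1 hxV, fun hx => ?_⟩
    obtain ⟨s, hs⟩ := hcover (f x)
    exact ⟨s, (hmem hs).2 hx, hs⟩

lemma exists_continuousMulEquiv_quotient_ker {G H : Type*} [Group G] [Group H]
    [TopologicalSpace G] [TopologicalSpace H] {f : G →* H} (hf : IsQuotientMap f) :
    ∃ e : (G ⧸ f.ker) ≃ₜ* H, ∀ x : G, e (QuotientGroup.mk x) = f x := by
  let e := QuotientGroup.quotientKerEquivOfSurjective f hf.surjective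
  have he : IsHomeomorph e := isHomeomorph_iff_isStrictMap_bijective.2
    ⟨(QuotientGroup.isQuotientMap_mk _).isStrictMap_iff.2 hf.isStrictMap, e.bijective⟩
  exact ⟨e.toContinuousMulEquiv fun _ => he.isQuotientMap.isOpen_preimage, fun _ => rfl⟩

namespace NonstandardExtension

variable {E : NonstandardExtension.{u, w}} {K : Type u} [Field K] [NumberField K]

lemma UnitsV.exists_isStandardPart (x : E.UnitsV K) : ∃ α, E.IsStandardPart x.val α := by
  obtain ⟨S, hS⟩ := Set.mem_iUnion.1 x.2
  exact NonstandardExtension.exists_isStandardPart hS.1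

variable (E K) in
/-- The canonical map `φ` from `U_V(*K)` to the ideles: the family of the standard parts of `x` at
all places. -/
noncomputable def standardPart : E.UnitsV K →* (AdeleRing (𝓞 K) K)ˣ :=
  MonoidHom.toHomUnits
    { toFun := fun x => x.exists_isStandardPart.choose
      map_one' := (1 : E.UnitsV K).exists_isStandardPart.choose_spec.unique isStandardPart_one
      map_mul' := fun x y => (x * y).exists_isStandardPart.choose_spec.unique
        (x.exists_isStandardPart.choose_spec.mul y.exists_isStandardPart.choose_spec) }

lemma isStandardPart_standardPart (x : E.UnitsV K) :
    E.IsStandardPart x.val (E.standardPart K x).val :=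
  x.exists_isStandardPart.choose_spec

lemma standardPart_mem_idelesS_iff {S : Finset (NFPlace K)} {x : E.UnitsV K} :
    E.standardPart K x ∈ idelesS S ↔ x.1 ∈ E.unitsVS K S := by
  have hinv := isStandardPart_standardPart x⁻¹
  rw [map_inv] at hinv
  exact and_congr (isStandardPart_standardPart x).mem_finVS_iff.symm hinv.mem_finVS_iff.symm

lemma range_unitsVSIncl (S : Finset (NFPlace K)) :
    Set.range (E.unitsVSIncl K S) = E.standardPart K ⁻¹' idelesS S := by
  ext x
  rw [Set.mem_preimage, SetLike.mem_coe, standardPart_mem_idelesS_iff]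
  exact ⟨fun ⟨y, hy⟩ => hy ▸ y.2, fun hx => ⟨⟨x.1, hx⟩, rfl⟩⟩

lemma unitsVSTopology_eq_induced (S : Finset (NFPlace K)) :
    E.unitsVSTopology K S = .induced (E.standardPart K ∘ E.unitsVSIncl K S) inferInstance := by
  have hS (y : E.unitsVS K S) : E.standardPart K (E.unitsVSIncl K S y) ∈ idelesS S :=
    standardPart_mem_idelesS_iff.2 y.2
  refine Eq.trans ?_ (induced_adeleCoords_eq_of_mem_idelesS hS)
  exact induced_uniformSpaceV_eq fun y =>
    isStandardPart_iff.1 (isStandardPart_standardPart (E.unitsVSIncl K S y))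

lemma isInducing_standardPart : IsInducing (E.standardPart K) where
  eq_induced := by
    refine Eq.trans ?_ (iSup_coinduced_induced_comp isOpen_idelesS exists_mem_idelesS
      range_unitsVSIncl)
    exact iSup_congr fun S => congrArg _ (unitsVSTopology_eq_induced S)

lemma exists_standardPart_eq {x : E.Ext K} {a : (AdeleRing (𝓞 K) K)ˣ}
    (h : E.IsStandardPart x a.val) : ∃ u : E.UnitsV K, u.val = x ∧ E.standardPart K u = a := by
  have hx : x * E.map (fun t => t⁻¹) x = 1 := mul_map_inv_cancel h.eventually_ne_zero
  let y : (E.Ext K)ˣ := ⟨x, E.map (fun t => t⁻¹) x, hx, by rw [mul_comm, hx]⟩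
  obtain ⟨S, hS⟩ := exists_mem_idelesS a
  have hy : y ∈ E.unitsVS K S := ⟨h.mem_finVS_iff.2 hS.1, h.map_inv.mem_finVS_iff.2 hS.2⟩
  exact ⟨E.unitsVSIncl K S ⟨y, hy⟩, rfl, Units.ext ((isStandardPart_standardPart _).unique h)⟩

lemma image_ker_standardPart :
    UnitsV.val '' ((E.standardPart K).ker : Set (E.UnitsV K)) =
      {x : E.Ext K | ∃ y ∈ E.infV K, x = 1 + y} := by
  ext x
  constructor
  · rintro ⟨u, hu, rfl⟩
    have h := isStandardPart_standardPart u
    rw [MonoidHom.mem_ker.1 hu, Units.val_one] at h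
    exact ⟨_, isStandardPart_one_iff.1 h, (add_sub_cancel _ _).symm⟩
  · rintro ⟨y, hy, rfl⟩
    obtain ⟨u, hux, hu⟩ := exists_standardPart_eq (x := 1 + y) (a := 1)
      (isStandardPart_one_iff.2 (by rwa [add_sub_cancel_left]))
    exact ⟨u, hu, hux⟩

lemma CountablySaturated.exists_isStandardPart (hE : E.CountablySaturated)
    (α : AdeleRing (𝓞 K) K) : ∃ x : E.Ext K, E.IsStandardPart x α := by
  let l := comap (algebraMap K (∀ v : NFPlace K, v.Completion)) (𝓝 (adeleCoords α))
  have : l.NeBot := comap_neBot fun U hU =>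
    have ⟨_, ⟨t, ht⟩, htU⟩ := NFPlace.denseRange_algebraMap_pi.inter_nhds_nonempty hU
    ⟨t, ht ▸ htU⟩
  obtain ⟨x, hx⟩ := hE.exists_type_le l
  exact ⟨x, isStandardPart_iff.2 (tendsto_iff_comap.2 hx)⟩

lemma CountablySaturated.surjective_standardPart (hE : E.CountablySaturated) :
    Function.Surjective (E.standardPart K) := fun a =>
  have ⟨_, hx⟩ := hE.exists_isStandardPart a.val
  have ⟨u, _, hu⟩ := exists_standardPart_eq hx
  ⟨u, hu⟩

end NonstandardExtension

theorem mainTheorem9 (E : NonstandardExtension.{u, w}) (hE : E.CountablySaturated)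
    (K : Type u) [Field K] [NumberField K] :
    IsTopologicalGroup (E.UnitsV K) ∧
    LocallyCompactSpace (E.UnitsV K) ∧
    ∃ φ : E.UnitsV K →* (NumberField.AdeleRing (𝓞 K) K)ˣ,
      (∀ x : E.UnitsV K,
        E.IsStandardPart x.val (φ x : NumberField.AdeleRing (𝓞 K) K)) ∧
      Continuous φ ∧
      Function.Surjective φ ∧
      NonstandardExtension.UnitsV.val '' (φ.ker : Set (E.UnitsV K)) =
        {x : E.Ext K | ∃ y ∈ E.infV K, x = 1 + y} ∧
      (φ.ker : Set (E.UnitsV K)) = closure {1} ∧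
      ∃ e : (E.UnitsV K ⧸ φ.ker) ≃ₜ* (NumberField.AdeleRing (𝓞 K) K)ˣ,
        ∀ x : E.UnitsV K, e (QuotientGroup.mk x) = φ x := by
  have hi : IsInducing (E.standardPart K) := NonstandardExtension.isInducing_standardPart
  have hs : Function.Surjective (E.standardPart K) := hE.surjective_standardPart
  refine ⟨hi.topologicalGroup, hi.locallyCompactSpace (hs.range_eq ▸ isOpen_univ.isLocallyClosed),
    E.standardPart K, NonstandardExtension.isStandardPart_standardPart, hi.continuous, hs,
    NonstandardExtension.image_ker_standardPart, ?_,
    exists_continuousMulEquiv_quotient_ker (hi.isQuotientMap_of_surjective hs)⟩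
  rw [hi.closure_eq_preimage_closure_image, Set.image_singleton, map_one, closure_singleton]
  rfl
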